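/- Let $p$ be a prime, let $k$ be an algebraically closed field of characteristic $p$, let $G$ be a finite group and let $P\neq 1$ be a $p$-subgroup of $G$. For a subgroup $H$ of a finite group $L$, let $S(L,H)$ be the Scott $kL$-module, i.e. the (up to isomorphism unique) indecomposable direct summand of $\mathrm{Ind}_H^L(k)$ whose socle contains the trivial $kL$-module $k$. For a $kL$-module $M$ put $\ker(M)=\{g\in L\mid gm=m \text{ for all } m\in M\}$, and for a $p$-subgroup $Q$ of $L$ let $M(Q)=M^Q/\sum_{R<Q}M_R^Q$ be the Brauer construction, a $kN_L(Q)$-module, where $M^Q$ is the space of $Q$-fixed points and $M_R^Q=\{\sum_{x\in[Q/R]}xm\mid m\in M^R\}$. A $kL$-module $M$ is called Brauer indecomposable if, for every $p$-subgroup $Q$ of $L$, the restriction of $M(Q)$ to $QC_L(Q)$ is indecomposable or zero. Assume that $P\leq\ker(S(G,P))$ and that $G$ is $p$-nilpotent, i.e. $G=KS$ for some Sylow $p$-subgroup $S$ of $G$ and some normal subgroup $K$ of $G$ of order prime to $p$. If $S(N_G(P),P)$ is Brauer indecomposable, then $S(G,P)$ is Brauer indecomposable. -/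

import Mathlib

/-- `G` is `p`-nilpotent: it has a normal `p`-complement, i.e. a normal `p'`-subgroup `K`
with `G = KS` for a Sylow `p`-subgroup `S` of `G`. -/
def IsPNilpotent (p : ℕ) (G : Type*) [Group G] : Prop :=
  ∃ (K : Subgroup G) (S : Sylow p G),
    K.Normal ∧ (Nat.card K).Coprime p ∧ K ⊔ (S : Subgroup G) = ⊤

namespace Representation

variable {k G V W : Type*} [Field k] [Group G] [AddCommGroup V] [Module k V]
  [AddCommGroup W] [Module k W]

/-- A `kG`-module is indecomposable if it is nonzero and is not the direct sum of two nonzero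
submodules. -/
def IsIndecomposable (ρ : Representation k G V) : Prop :=
  Nontrivial V ∧ ∀ U₁ U₂ : Subrepresentation ρ, IsCompl U₁ U₂ → U₁ = ⊥ ∨ U₂ = ⊥

/-- `ρ` is isomorphic to a direct summand of `σ`. -/
def IsSummandOf (ρ : Representation k G V) (σ : Representation k G W) : Prop :=
  ∃ U₁ U₂ : Subrepresentation σ, IsCompl U₁ U₂ ∧ Nonempty (ρ.Equiv U₁.toRepresentation)

/-- `ρ` is (a representative of the isomorphism class of) the Scott module `S(G, H)`: the
indecomposable direct summand of `Ind_H^G k` whose socle contains the trivial module, that is,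
which has a submodule isomorphic to the trivial module `k`. -/
def IsScottModule (H : Subgroup G) (ρ : Representation k G V) : Prop :=
  ρ.IsIndecomposable ∧ ρ.IsSummandOf (ind H.subtype (trivial k H k)) ∧
    ∃ U : Subrepresentation ρ, Nonempty ((trivial k G k).Equiv U.toRepresentation)

/-- The subspace `M^Q` of `Q`-fixed points. -/
noncomputable def fixedBy (ρ : Representation k G V) (Q : Subgroup G) : Submodule k V :=
  invariants (ρ.comp Q.subtype)

/-- The map `m ↦ ∑ x m`, where `x` runs over coset representatives of `R` in `Q`; it is used
only on `M^R`, where the choice of the representatives is irrelevant. -/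
noncomputable def relTrace (ρ : Representation k G V) (R Q : Subgroup G) : V →ₗ[k] V :=
  ∑ᶠ x : Q ⧸ R.subgroupOf Q, ρ (x.out : Q)

/-- `∑_{R < Q} M_R^Q`, where `M_R^Q` is the image of `M^R` under the relative trace. -/
noncomputable def traceSum (ρ : Representation k G V) (Q : Subgroup G) : Submodule k V :=
  ⨆ (R : Subgroup G) (_ : R < Q), (ρ.fixedBy R).map (ρ.relTrace R Q)

lemma mem_fixedBy {ρ : Representation k G V} {Q : Subgroup G} {v : V} :
    v ∈ ρ.fixedBy Q ↔ ∀ g ∈ Q, ρ g v = v := by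
  simp [fixedBy, mem_invariants]

lemma relTrace_apply [Finite G] (ρ : Representation k G V) (R Q : Subgroup G) (v : V) :
    ρ.relTrace R Q v = ∑ᶠ x : Q ⧸ R.subgroupOf Q, ρ (x.out : Q) v := by
  classical
  have := Fintype.ofFinite (Q ⧸ R.subgroupOf Q)
  rw [relTrace, finsum_eq_sum_of_fintype, finsum_eq_sum_of_fintype, LinearMap.sum_apply]

lemma conj_mem_iff {Q : Subgroup G} {g : G} (hg : g ∈ Subgroup.normalizer (Q : Set G)) (x : G) :
    g * x * g⁻¹ ∈ Q ↔ x ∈ Q :=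
  (Subgroup.mem_normalizer_iff.1 hg x).symm

lemma fixedBy_le_comap (ρ : Representation k G V) (Q : Subgroup G)
    (g : Subgroup.normalizer (Q : Set G)) : ρ.fixedBy Q ≤ (ρ.fixedBy Q).comap (ρ (g : G)) := by
  intro v hv
  rw [Submodule.mem_comap, mem_fixedBy]
  intro x hx
  have h : (g : G)⁻¹ * x * g ∈ Q := by
    rw [← conj_mem_iff g.2]
    simpa [mul_assoc] using hx
  have h2 := mem_fixedBy.1 hv _ h
  calc ρ x (ρ g v) = ρ g (ρ ((g : G)⁻¹ * x * g) v) := by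
        simp only [← Module.End.mul_apply, ← map_mul]
        simp [mul_assoc]
    _ = ρ g v := by rw [h2]

lemma relTrace_conj [Finite G] (ρ : Representation k G V) {R Q : Subgroup G} {g : G}
    (hg : g ∈ Subgroup.normalizer (Q : Set G)) {v : V} (hv : v ∈ ρ.fixedBy R) :
    ρ g (ρ.relTrace R Q v) =
      ρ.relTrace (R.map (MulAut.conj g).toMonoidHom) Q (ρ g v) := by
  have hmem : ∀ y : G, g * y * g⁻¹ ∈ R.map (MulAut.conj g).toMonoidHom ↔ y ∈ R := fun y => by
    simp [Subgroup.mem_map]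
  have hQ : ∀ y : G, g * y * g⁻¹ ∈ Q ↔ y ∈ Q := conj_mem_iff hg
  let c : Q → Q := fun y => ⟨g * y * g⁻¹, (hQ y).2 y.2⟩
  have hc : ∀ x y : Q, (QuotientGroup.mk (c x) :
      Q ⧸ (R.map (MulAut.conj g).toMonoidHom).subgroupOf Q) = QuotientGroup.mk (c y) ↔
      (QuotientGroup.mk x : Q ⧸ R.subgroupOf Q) = QuotientGroup.mk y := fun x y => by
    rw [QuotientGroup.eq, QuotientGroup.eq, Subgroup.mem_subgroupOf, Subgroup.mem_subgroupOf,
      ← hmem]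
    simp [c, mul_assoc]
  rw [relTrace_apply, relTrace_apply, map_finsum _ (Set.toFinite _)]
  refine finsum_eq_of_bijective (fun x => QuotientGroup.mk (c x.out)) ⟨?_, ?_⟩ ?_
  · intro x y hxy
    simpa using (hc _ _).1 hxy
  · intro y
    have hy : g⁻¹ * (y.out : Q) * g ∈ Q := by
      rw [← hQ]; simp [mul_assoc]
    refine ⟨QuotientGroup.mk ⟨_, hy⟩, ?_⟩
    have h1 : c ⟨_, hy⟩ = y.out := Subtype.ext (by simp [c, mul_assoc])
    exact ((hc _ _).2 (QuotientGroup.out_eq' _)).trans (by rw [h1, QuotientGroup.out_eq'])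
  · intro x
    obtain ⟨r, hr⟩ := QuotientGroup.mk_out_eq_mul
      ((R.map (MulAut.conj g).toMonoidHom).subgroupOf Q) (c x.out)
    obtain ⟨s, hs, hsr⟩ := Subgroup.mem_map.1 (Subgroup.mem_subgroupOf.1 r.2)
    have hsr' : ((r : Q) : G) = g * s * g⁻¹ := by simpa using hsr.symm
    rw [hr, Subgroup.coe_mul, hsr']
    calc ρ g (ρ (x.out : Q) v) = ρ g (ρ (x.out : Q) (ρ s v)) := by
          rw [mem_fixedBy.1 hv s hs]
      _ = _ := by
          simp only [← Module.End.mul_apply, ← map_mul]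
          simp [c, mul_assoc]

lemma traceSum_le_comap [Finite G] (ρ : Representation k G V) (Q : Subgroup G)
    (g : Subgroup.normalizer (Q : Set G)) : ρ.traceSum Q ≤ (ρ.traceSum Q).comap (ρ (g : G)) := by
  refine iSup₂_le fun R hR => ?_
  rintro _ ⟨v, hv, rfl⟩
  rw [Submodule.mem_comap, relTrace_conj ρ g.2 hv]
  have hmem : ∀ y : G,
      (g : G) * y * (g : G)⁻¹ ∈ R.map (MulAut.conj (g : G)).toMonoidHom ↔ y ∈ R := fun y => by
    simp [Subgroup.mem_map]
  have hlt : R.map (MulAut.conj (g : G)).toMonoidHom < Q := by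
    refine lt_of_le_not_ge ?_ fun h => hR.not_ge fun y hy =>
      (hmem y).1 (h ((conj_mem_iff g.2 y).2 hy))
    rintro _ ⟨y, hy, rfl⟩
    simpa using (conj_mem_iff g.2 y).2 (hR.le hy)
  refine Submodule.mem_iSup_of_mem _ (Submodule.mem_iSup_of_mem hlt
    (Submodule.mem_map_of_mem ?_))
  rw [mem_fixedBy]
  rintro _ ⟨y, hy, rfl⟩
  calc ρ ((MulAut.conj (g : G)).toMonoidHom y) (ρ g v) = ρ g (ρ y v) := by
        simp only [← Module.End.mul_apply, ← map_mul]
        simp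
    _ = ρ g v := by rw [mem_fixedBy.1 hv y hy]

/-- The action of `N_G(Q)` on `M^Q`. -/
noncomputable def fixedByRep (ρ : Representation k G V) (Q : Subgroup G) :
    Representation k (Subgroup.normalizer (Q : Set G)) (ρ.fixedBy Q) :=
  subrepresentation (ρ.comp (Subgroup.normalizer (Q : Set G)).subtype) (ρ.fixedBy Q)
    (ρ.fixedBy_le_comap Q)

/-- The Brauer construction `M(Q) = M^Q / ∑_{R < Q} M_R^Q`, as a `kN_G(Q)`-module. -/
noncomputable def brauer [Finite G] (ρ : Representation k G V) (Q : Subgroup G) :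
    Representation k (Subgroup.normalizer (Q : Set G))
      (ρ.fixedBy Q ⧸ (ρ.traceSum Q).submoduleOf (ρ.fixedBy Q)) :=
  (ρ.fixedByRep Q).quotient ((ρ.traceSum Q).submoduleOf (ρ.fixedBy Q))
    fun g _ hv => ρ.traceSum_le_comap Q g hv

/-- `M` is Brauer indecomposable: for every `p`-subgroup `Q` of `G`, the restriction of `M(Q)`
to the subgroup `QC_G(Q)` of `N_G(Q)` is indecomposable or zero. -/
def IsBrauerIndecomposable [Finite G] (p : ℕ) (ρ : Representation k G V) : Prop :=
  ∀ Q : Subgroup G, IsPGroup p Q →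
    IsIndecomposable ((ρ.brauer Q).comp
      ((Q ⊔ Subgroup.centralizer (Q : Set G)).subgroupOf
        (Subgroup.normalizer (Q : Set G))).subtype) ∨
    Subsingleton (ρ.fixedBy Q ⧸ (ρ.traceSum Q).submoduleOf (ρ.fixedBy Q))

end Representation

/-!
Let `K` be the normal `p`-complement of `G` and `L = KP`. Averaging over `K` splits off the
`K`-fixed points of any module as a summand; those of `S(G, P)` are nonzero, so `K` acts trivially,
and Frobenius reciprocity makes `S(G, P)` a direct summand of `k[G/L]`. The latter is
indecomposable: any two nonzero summands would both contain nonzero fixed vectors of the `p`-group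
`G/K`, while the fixed space is a line. So `S(G, P) ≅ k[G/L]`, and
`P ≤ ker S(G, P)` forces `L` to be normal in `G`.

If `L` is normal and `M = k[G/L]`, then `M(Q) = M` for every `p`-subgroup `Q ≤ L`, because all
relative traces vanish, and `M(Q) = 0` for every other `Q`, because `Q` then fixes no point of
`G/L`. As `M` restricted to a subgroup `H` is indecomposable exactly when `HL = G`, Brauer
indecomposability of `M` means that `C_G(Q)L = G` for all `p`-subgroups `Q ≤ L`. Applied to
`S(N_G(P), P)`, the same computation turns the hypothesis into `N_G(P) ≤ C_G(P)L`. As `P` is a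
Sylow subgroup of `L`, the Frattini argument gives `C_G(P)L = N_G(P)L = G`, and Sylow conjugacy in
`L` passes this on to every `p`-subgroup `Q` of `L`.
-/

namespace ScottModule

open Representation

section Indecomposable

variable {k G H V W : Type*} [Field k] [Group G] [Group H] [AddCommGroup V] [Module k V]
  [AddCommGroup W] [Module k W]

lemma isCompl_toSubmodule_iff {ρ : Representation k G V} {U₁ U₂ : Subrepresentation ρ} :
    IsCompl U₁.toSubmodule U₂.toSubmodule ↔ IsCompl U₁ U₂ := by
  simp only [isCompl_iff, disjoint_iff, codisjoint_iff,
    ← Subrepresentation.toSubmodule_injective.eq_iff]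
  rfl

/-- The correspondence between the subrepresentations of `ρ` and those of `τ` induced by a linear
isomorphism that is equivariant along a surjection of groups; it lets indecomposability be compared
for modules over different groups. -/
def subrepresentationOrderIso {ρ : Representation k G V} {τ : Representation k H W} (e : V ≃ₗ[k] W)
    {f : G →* H} (hf : Function.Surjective f) (he : ∀ g v, e (ρ g v) = τ (f g) (e v)) :
    Subrepresentation ρ ≃o Subrepresentation τ where
  toFun U := ⟨U.toSubmodule.map e.toLinearMap, by
    rw [hf.forall]
    rintro g _ ⟨v, hv, rfl⟩
    exact ⟨ρ g v, U.apply_mem_toSubmodule g hv, he g v⟩⟩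
  invFun U := ⟨U.toSubmodule.comap e.toLinearMap, fun g v hv => by
    rw [Submodule.mem_comap, LinearEquiv.coe_coe, he]
    exact U.apply_mem_toSubmodule (f g) hv⟩
  left_inv U := Subrepresentation.toSubmodule_injective
    ((Submodule.orderIsoMapComap e).symm_apply_apply U.toSubmodule)
  right_inv U := Subrepresentation.toSubmodule_injective
    ((Submodule.orderIsoMapComap e).apply_symm_apply U.toSubmodule)
  map_rel_iff' {U₁ U₂} :=
    (Submodule.orderIsoMapComap e).le_iff_le (x := U₁.toSubmodule) (y := U₂.toSubmodule)

lemma isIndecomposable_iff_of_linearEquiv {ρ : Representation k G V} {τ : Representation k H W}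
    (e : V ≃ₗ[k] W) {f : G →* H} (hf : Function.Surjective f)
    (he : ∀ g v, e (ρ g v) = τ (f g) (e v)) : IsIndecomposable ρ ↔ IsIndecomposable τ := by
  let o := subrepresentationOrderIso e hf he
  refine and_congr e.toEquiv.nontrivial_congr ?_
  rw [o.surjective.forall₂]
  simp only [← o.isCompl_iff, map_eq_bot_iff]

variable {ρ : Representation k G V} {τ : Representation k G W}

lemma eq_zero_or_eq_one_of_isIdempotentElem (hρ : IsIndecomposable ρ) {a : IntertwiningMap ρ ρ}
    (ha : IsIdempotentElem a) : a = 0 ∨ a = 1 := by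
  have ha' : IsIdempotentElem a.toLinearMap := congrArg IntertwiningMap.toLinearMap ha
  have hcompl : IsCompl a.range a.ker :=
    isCompl_toSubmodule_iff.1 (LinearMap.IsIdempotentElem.isCompl ha')
  refine (hρ.2 _ _ hcompl).imp (fun h => ?_) (fun h => ?_)
  · refine IntertwiningMap.ext (LinearMap.range_eq_bot.1 ?_)
    exact congrArg Subrepresentation.toSubmodule h
  · have hinj : Function.Injective a :=
      LinearMap.ker_eq_bot.1 (congrArg Subrepresentation.toSubmodule h)
    exact IntertwiningMap.ext (LinearMap.ext fun v => hinj (LinearMap.congr_fun ha' v))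

lemma bijective_of_comp_eq_id (hτ : IsIndecomposable τ) [Nontrivial V] {f : IntertwiningMap τ ρ}
    {s : IntertwiningMap ρ τ} (hfs : f.comp s = .id ρ) : Function.Bijective f := by
  have hfs' : Function.LeftInverse f s := DFunLike.congr_fun hfs
  have hidem : IsIdempotentElem (s.comp f) :=
    DFunLike.ext _ _ fun w => congrArg s (hfs' (f w))
  rcases eq_zero_or_eq_one_of_isIdempotentElem hτ hidem with h | h
  · obtain ⟨v, hv⟩ := exists_ne (0 : V)
    refine absurd ?_ hv
    calc v = f (s (f (s v))) := by rw [hfs', hfs']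
      _ = f 0 := congrArg f (DFunLike.congr_fun h (s v))
      _ = 0 := map_zero f
  · exact ⟨Function.LeftInverse.injective (g := s) (DFunLike.congr_fun h), hfs'.surjective⟩

lemma exists_comp_eq_id_of_isSummandOf (h : IsSummandOf ρ τ) :
    ∃ (i : IntertwiningMap ρ τ) (π : IntertwiningMap τ ρ), π.comp i = .id ρ := by
  obtain ⟨U₁, U₂, hU, ⟨e⟩⟩ := h
  have hU' := isCompl_toSubmodule_iff.2 hU
  let incl : IntertwiningMap U₁.toRepresentation τ := ⟨U₁.toSubmodule.subtype, fun g => rfl⟩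
  let proj : IntertwiningMap τ U₁.toRepresentation :=
    ⟨U₁.toSubmodule.projectionOnto U₂.toSubmodule hU', fun g => by
      refine LinearMap.ext fun w => ?_
      obtain ⟨u₁, h₁, u₂, h₂, rfl⟩ := Submodule.mem_sup.1
        (hU'.sup_eq_top ▸ Submodule.mem_top : w ∈ U₁.toSubmodule ⊔ U₂.toSubmodule)
      simp only [LinearMap.comp_apply, map_add,
        Submodule.projectionOnto_apply_of_mem_right hU' h₂,
        Submodule.projectionOnto_apply_of_mem_right hU' (U₂.apply_mem_toSubmodule g h₂),
        Submodule.projectionOnto_apply_of_mem_left hU' h₁,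
        Submodule.projectionOnto_apply_of_mem_left hU' (U₁.apply_mem_toSubmodule g h₁), map_zero]
      rfl⟩
  refine ⟨incl.comp e.toIntertwiningMap, e.symm.toIntertwiningMap.comp proj,
    DFunLike.ext _ _ fun v => ?_⟩
  calc e.symm (proj (e v : W)) = e.symm (e v) :=
        congrArg e.symm (Submodule.projectionOnto_apply_left hU' (e v))
    _ = v := e.symm_apply_apply v

end Indecomposable

section FixedVectors

variable {p : ℕ} [Fact p.Prime]

lemma finite_closure_of_nsmul_eq_zero {A : Type*} [AddCommGroup A] (hA : ∀ a : A, p • a = 0)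
    {s : Set A} (hs : s.Finite) : Finite (AddSubgroup.closure s) := by
  have : AddGroup.FG (AddSubgroup.closure s) :=
    (AddGroup.fg_iff_addSubgroup_fg _).2 ((AddSubgroup.fg_iff _).2 ⟨s, rfl, hs⟩)
  exact AddCommGroup.finite_of_fg_isAddTorsion _ fun a => isOfFinAddOrder_iff_nsmul_eq_zero.2
    ⟨p, (Fact.out : p.Prime).pos, Subtype.ext (hA a)⟩

lemma exists_ne_zero_forall_smul_eq {Γ A : Type*} [Group Γ] [Finite Γ] [AddCommGroup A]
    [DistribMulAction Γ A] [Nontrivial A] (hΓ : IsPGroup p Γ) (hA : ∀ a : A, p • a = 0) :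
    ∃ a : A, a ≠ 0 ∧ ∀ g : Γ, g • a = a := by
  -- `A` may be infinite, so fixed points are counted in the finite subgroup generated by an orbit.
  obtain ⟨a, ha⟩ := exists_ne (0 : A)
  let B : SubMulAction Γ A :=
    { carrier := AddSubgroup.closure (MulAction.orbit Γ a)
      smul_mem' := fun g b hb => by
        refine AddSubgroup.closure_induction (fun x hx => ?_) ?_ (fun x y _ _ hx hy => ?_)
          (fun x _ hx => ?_) hb
        · exact AddSubgroup.subset_closure (MulAction.mem_orbit_of_mem_orbit g hx)
        · simp
        · simpa using add_mem hx hy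
        · simpa using hx }
  have hBfin : Finite B := finite_closure_of_nsmul_eq_zero hA
    (Set.finite_range fun g : Γ => g • a)
  let a' : AddSubgroup.closure (MulAction.orbit Γ a) :=
    ⟨a, AddSubgroup.subset_closure (MulAction.mem_orbit_self a)⟩
  have hcard : p ∣ Nat.card B := by
    have hord : addOrderOf a' = p :=
      addOrderOf_eq_prime (Subtype.ext (hA a)) fun h => ha (congrArg Subtype.val h)
    exact hord ▸ addOrderOf_dvd_natCard a'
  obtain ⟨b, hb, hb0⟩ := hΓ.exists_fixed_point_of_prime_dvd_card_of_fixed_point B hcard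
    (a := ⟨0, AddSubgroup.zero_mem _⟩) fun g => Subtype.ext (smul_zero g)
  exact ⟨b, fun h => hb0 (Subtype.ext h.symm), fun g => congrArg Subtype.val (hb g)⟩

variable {k G V : Type*} [Field k] [CharP k p] [Group G] [AddCommGroup V] [Module k V]

lemma exists_mem_invariants_ne_zero {ρ : Representation k G V} [Nontrivial V] {N : Subgroup G}
    [N.Normal] [N.FiniteIndex] (hN : N ≤ MonoidHom.ker ρ) (hGN : IsPGroup p (G ⧸ N)) :
    ∃ v ∈ invariants ρ, v ≠ 0 := by
  let _ : DistribMulAction (G ⧸ N) V := DistribMulAction.compHom V (QuotientGroup.lift N ρ hN)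
  have hpV : ∀ v : V, p • v = 0 := fun v => by
    rw [← Nat.cast_smul_eq_nsmul k, CharP.cast_eq_zero, zero_smul]
  obtain ⟨v, hv, hfix⟩ := exists_ne_zero_forall_smul_eq hGN hpV
  exact ⟨v, fun g => hfix g, hv⟩

lemma exists_mem_invariants_mem_ne_zero {ρ : Representation k G V} {N : Subgroup G} [N.Normal]
    [N.FiniteIndex] (hN : N ≤ MonoidHom.ker ρ) (hGN : IsPGroup p (G ⧸ N))
    {U : Subrepresentation ρ} (hU : U ≠ ⊥) : ∃ v ∈ invariants ρ, v ∈ U.toSubmodule ∧ v ≠ 0 := by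
  have : Nontrivial U.toSubmodule := U.toSubmodule.nontrivial_iff_ne_bot.2 fun h =>
    hU (Subrepresentation.toSubmodule_injective h)
  have hNU : N ≤ MonoidHom.ker U.toRepresentation := fun g hg =>
    LinearMap.ext fun u => Subtype.ext (LinearMap.congr_fun (hN hg) u)
  obtain ⟨u, hu, hu0⟩ := exists_mem_invariants_ne_zero hNU hGN
  exact ⟨u, fun g => congrArg Subtype.val (hu g), u.2, fun h => hu0 (Subtype.ext h)⟩

end FixedVectors

section PermutationBasis

variable {k G V X : Type*} [Field k] [Group G] [AddCommGroup V] [Module k V] [MulAction G X]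

/-- `b` is a permutation basis of `ρ`: the group permutes the basis vectors through its action on
the index set, so that `ρ` is the permutation module `k[X]`. -/
def IsPermutationBasis (ρ : Representation k G V) (b : Module.Basis X k V) : Prop :=
  ∀ g x, ρ g (b x) = b (g • x)

namespace IsPermutationBasis

variable {ρ : Representation k G V} {b : Module.Basis X k V}

lemma repr_apply (hb : IsPermutationBasis ρ b) (g : G) (v : V) (x : X) :
    b.repr (ρ g v) x = b.repr v (g⁻¹ • x) := by
  classical
  have h : (Finsupp.lapply x ∘ₗ b.repr.toLinearMap) ∘ₗ ρ g =
      Finsupp.lapply (g⁻¹ • x) ∘ₗ b.repr.toLinearMap := b.ext fun y => by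
    simp [hb g y, Finsupp.single_apply, eq_inv_smul_iff]
  exact LinearMap.congr_fun h v

lemma repr_eq_of_mem_fixedBy (hb : IsPermutationBasis ρ b) {Q : Subgroup G} {v : V}
    (hv : v ∈ ρ.fixedBy Q) (q : Q) (x : X) : b.repr v (q • x) = b.repr v x := by
  rw [Subgroup.smul_def, ← inv_inv (q : G), ← hb.repr_apply,
    mem_fixedBy.1 hv _ (inv_mem q.2)]

lemma ker_eq (hb : IsPermutationBasis ρ b) :
    MonoidHom.ker ρ = (MulAction.toPermHom G X).ker := by
  ext g
  simp only [MonoidHom.mem_ker, Equiv.ext_iff, MulAction.toPermHom_apply, MulAction.toPerm_apply,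
    Equiv.Perm.one_apply]
  refine ⟨fun h x => b.injective ?_, fun h => b.ext fun x => ?_⟩
  · rw [← hb, h, Module.End.one_apply]
  · rw [hb, h, Module.End.one_apply]

lemma comp_subtype (hb : IsPermutationBasis ρ b) (H : Subgroup G) :
    IsPermutationBasis (ρ.comp H.subtype) b :=
  fun h => hb h

lemma smul_eq_smul_of_mem_invariants (hb : IsPermutationBasis ρ b) [MulAction.IsPretransitive G X]
    {v w : V} (hv : v ∈ invariants ρ) (hw : w ∈ invariants ρ) (x : X) :
    b.repr w x • v = b.repr v x • w := by
  have hconst : ∀ u ∈ invariants ρ, ∀ y, b.repr u y = b.repr u x := fun u hu y => by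
    obtain ⟨g, rfl⟩ := MulAction.exists_smul_eq G y x
    rw [← inv_smul_smul g y, ← hb.repr_apply, hu, inv_smul_smul]
  refine b.repr.injective (Finsupp.ext fun y => ?_)
  simp only [map_smul, Finsupp.smul_apply, smul_eq_mul, hconst v hv y, hconst w hw y, mul_comm]

theorem isIndecomposable (hb : IsPermutationBasis ρ b) [Nonempty X]
    [MulAction.IsPretransitive G X] {p : ℕ} [Fact p.Prime] [CharP k p] {N : Subgroup G} [N.Normal]
    [N.FiniteIndex] (hN : N ≤ MonoidHom.ker ρ) (hGN : IsPGroup p (G ⧸ N)) :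
    IsIndecomposable ρ := by
  refine ⟨⟨b (Classical.arbitrary X), 0, b.ne_zero _⟩, fun U₁ U₂ hU => ?_⟩
  by_contra! h
  obtain ⟨v, hv, hvU, hv0⟩ := exists_mem_invariants_mem_ne_zero hN hGN h.1
  obtain ⟨w, hw, hwU, hw0⟩ := exists_mem_invariants_mem_ne_zero hN hGN h.2
  obtain ⟨x, hx⟩ : ∃ x, b.repr v x ≠ 0 :=
    Finsupp.ne_iff.1 fun hv' => hv0 (b.repr.map_eq_zero_iff.1 hv')
  have hzero : b.repr v x • w = 0 :=
    Submodule.disjoint_def.1 (isCompl_toSubmodule_iff.2 hU).disjoint _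
      (hb.smul_eq_smul_of_mem_invariants hv hw x ▸ U₁.toSubmodule.smul_mem _ hvU)
      (U₂.toSubmodule.smul_mem _ hwU)
  exact smul_ne_zero hx hw0 hzero

/-- The subrepresentation spanned by the part of a permutation basis indexed by a stable set. -/
def spanImage (hb : IsPermutationBasis ρ b) (s : Set X)
    (hs : ∀ (g : G), ∀ x ∈ s, g • x ∈ s) : Subrepresentation ρ where
  toSubmodule := Submodule.span k (b '' s)
  apply_mem_toSubmodule g v hv := by
    have h : Submodule.span k (b '' s) ≤ (Submodule.span k (b '' s)).comap (ρ g) :=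
      Submodule.span_le.2 <| Set.forall_mem_image.2 fun x hx =>
        Submodule.subset_span ⟨g • x, hs g x hx, (hb g x).symm⟩
    exact h hv

lemma spanImage_ne_bot (hb : IsPermutationBasis ρ b) {s : Set X}
    (hs : ∀ (g : G), ∀ x ∈ s, g • x ∈ s) (hne : s.Nonempty) : hb.spanImage s hs ≠ ⊥ := by
  obtain ⟨x, hx⟩ := hne
  intro h
  have hmem : b x ∈ (hb.spanImage s hs).toSubmodule := Submodule.subset_span ⟨x, hx, rfl⟩
  rw [h] at hmem
  exact b.ne_zero x hmem

lemma isCompl_spanImage (hb : IsPermutationBasis ρ b) {s t : Set X}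
    (hs : ∀ (g : G), ∀ x ∈ s, g • x ∈ s) (ht : ∀ (g : G), ∀ x ∈ t, g • x ∈ t)
    (hst : IsCompl s t) : IsCompl (hb.spanImage s hs) (hb.spanImage t ht) := by
  rw [← isCompl_toSubmodule_iff]
  refine ⟨b.linearIndependent.disjoint_span_image hst.disjoint, codisjoint_iff.2 ?_⟩
  have hunion : s ∪ t = Set.univ := hst.sup_eq_top
  change Submodule.span k (b '' s) ⊔ Submodule.span k (b '' t) = ⊤
  rw [← Submodule.span_union, ← Set.image_union, hunion, Set.image_univ, b.span_eq]

theorem isPretransitive_of_isIndecomposable (hb : IsPermutationBasis ρ b)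
    (hρ : IsIndecomposable ρ) : MulAction.IsPretransitive G X := by
  refine ⟨fun x y => ?_⟩
  have hs : ∀ (g : G), ∀ z ∈ MulAction.orbit G x, g • z ∈ MulAction.orbit G x :=
    fun g z => MulAction.mem_orbit_of_mem_orbit g
  have ht : ∀ (g : G), ∀ z ∈ (MulAction.orbit G x)ᶜ, g • z ∈ (MulAction.orbit G x)ᶜ :=
    fun g z hz h => hz (by simpa using hs g⁻¹ _ h)
  by_contra hxy
  rcases hρ.2 _ _ (hb.isCompl_spanImage hs ht isCompl_compl) with h | h
  · exact hb.spanImage_ne_bot hs ⟨x, MulAction.mem_orbit_self x⟩ h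
  · exact hb.spanImage_ne_bot ht ⟨y, hxy⟩ h

end IsPermutationBasis

end PermutationBasis

section NormalSubgroups

open scoped Pointwise

variable {p : ℕ} {G : Type*} [Group G]

lemma isPGroup_quotient_iff {N : Subgroup G} [N.Normal] :
    IsPGroup p (G ⧸ N) ↔ ∀ g : G, ∃ n : ℕ, g ^ p ^ n ∈ N := by
  rw [isPGroup_iff_pow_pow_eq_one, QuotientGroup.mk_surjective.forall]
  simp only [← QuotientGroup.mk_pow, QuotientGroup.eq_one_iff]

lemma isPGroup_quotient_mono {N L : Subgroup G} [N.Normal] [L.Normal] (hNL : N ≤ L)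
    (hN : IsPGroup p (G ⧸ N)) : IsPGroup p (G ⧸ L) :=
  isPGroup_quotient_iff.2 fun g => (isPGroup_quotient_iff.1 hN g).imp fun _ hn => hNL hn

lemma isPGroup_quotient_subgroupOf {N : Subgroup G} [N.Normal] (hN : IsPGroup p (G ⧸ N))
    (H : Subgroup G) : IsPGroup p (H ⧸ N.subgroupOf H) :=
  isPGroup_quotient_iff.2 fun h => isPGroup_quotient_iff.1 hN h

lemma dvd_relIndex_of_lt [Fact p.Prime] [Finite G] {R Q : Subgroup G} (hQ : IsPGroup p Q)
    (hRQ : R < Q) : p ∣ R.relIndex Q := by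
  obtain ⟨n, hn⟩ : ∃ n, R.relIndex Q = p ^ n := hQ.index (R.subgroupOf Q)
  have hn0 : n ≠ 0 := by
    rintro rfl
    exact hRQ.not_ge (Subgroup.relIndex_eq_one.1 (hn.trans (pow_zero p)))
  exact hn ▸ dvd_pow_self p hn0

lemma stabilizer_quotient_of_normal {L : Subgroup G} [hL : L.Normal] (x : G ⧸ L) :
    MulAction.stabilizer G x = L := by
  obtain ⟨a, rfl⟩ := QuotientGroup.mk_surjective x
  ext g
  rw [MulAction.mem_stabilizer_iff, MulAction.Quotient.smul_mk, eq_comm, QuotientGroup.eq,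
    smul_eq_mul, hL.mem_comm_iff, mul_inv_cancel_right]

lemma isPretransitive_iff_mul_stabilizer_eq_univ {X : Type*} [MulAction G X]
    [MulAction.IsPretransitive G X] {H : Subgroup G} (x : X) :
    MulAction.IsPretransitive H X ↔
      (H : Set G) * (MulAction.stabilizer G x : Set G) = Set.univ := by
  rw [MulAction.isPretransitive_iff_base x, Set.eq_univ_iff_forall,
    (MulAction.surjective_smul G x).forall]
  refine forall_congr' fun g => ⟨?_, ?_⟩
  · rintro ⟨h, hh⟩
    refine Set.mem_mul.2 ⟨h, h.2, (h : G)⁻¹ * g, ?_, mul_inv_cancel_left _ _⟩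
    rw [SetLike.mem_coe, MulAction.mem_stabilizer_iff, mul_smul, ← hh]
    exact inv_smul_smul (h : G) x
  · rintro ⟨h, hh, s, hs, rfl⟩
    exact ⟨⟨h, hh⟩, ((mul_smul h s x).trans (congrArg (h • ·) hs)).symm⟩

end NormalSubgroups

section QuotientBasis

variable {k G V : Type*} [Field k] [Group G] [AddCommGroup V] [Module k V] {L : Subgroup G}
  {ρ : Representation k G V} {b : Module.Basis (G ⧸ L) k V}

namespace IsPermutationBasis

lemma ker_eq_normalCore (hb : IsPermutationBasis ρ b) : MonoidHom.ker ρ = L.normalCore :=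
  hb.ker_eq.trans L.normalCore_eq_ker.symm

lemma ker_eq_of_normal (hb : IsPermutationBasis ρ b) [L.Normal] : MonoidHom.ker ρ = L :=
  hb.ker_eq_normalCore.trans L.normalCore_eq_self

theorem isIndecomposable_comp_subtype_iff (hb : IsPermutationBasis ρ b) [L.Normal]
    [L.FiniteIndex] {p : ℕ} [Fact p.Prime] [CharP k p] (hGL : IsPGroup p (G ⧸ L)) {H : Subgroup G} :
    IsIndecomposable (ρ.comp H.subtype) ↔ H ⊔ L = ⊤ := by
  rw [← Subgroup.coe_eq_univ, Subgroup.mul_normal, ← MulAction.stabilizer_quotient L,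
    ← isPretransitive_iff_mul_stabilizer_eq_univ]
  refine ⟨(hb.comp_subtype H).isPretransitive_of_isIndecomposable, fun _ =>
    (hb.comp_subtype H).isIndecomposable (p := p) (N := L.subgroupOf H)
      (fun _ hh => hb.ker_eq_of_normal.ge hh) (isPGroup_quotient_subgroupOf hGL H)⟩

end IsPermutationBasis

end QuotientBasis

section Brauer

variable {k G V X : Type*} [Field k] [Group G] [AddCommGroup V] [Module k V]
  {ρ : Representation k G V} {Q : Subgroup G}

lemma fixedBy_eq_top_of_le_ker (h : Q ≤ MonoidHom.ker ρ) : ρ.fixedBy Q = ⊤ :=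
  eq_top_iff.2 fun v _ => mem_fixedBy.2 fun _ hg => LinearMap.congr_fun (h hg) v

lemma subsingleton_brauer_iff :
    Subsingleton (ρ.fixedBy Q ⧸ (ρ.traceSum Q).submoduleOf (ρ.fixedBy Q)) ↔
      ρ.fixedBy Q ≤ ρ.traceSum Q :=
  Submodule.Quotient.subsingleton_iff.trans Submodule.submoduleOf_eq_top

namespace IsPermutationBasis

variable [MulAction G X] {b : Module.Basis X k V}

lemma mem_span_orbit_sums [Finite X] (hb : IsPermutationBasis ρ b) {v : V}
    (hv : v ∈ ρ.fixedBy Q) :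
    v ∈ Submodule.span k (Set.range fun x : X => ∑ᶠ y : MulAction.orbit Q x, b y) := by
  classical
  have := Fintype.ofFinite X
  have hsum : v = ∑ ω : MulAction.orbitRel.Quotient Q X,
      b.repr v ω.out • ∑ y : MulAction.orbit Q ω.out, b y := by
    calc v = ∑ x, b.repr v x • b x := (b.sum_repr v).symm
      _ = ∑ z : Σ ω : MulAction.orbitRel.Quotient Q X, MulAction.orbit Q ω.out,
          b.repr v z.2 • b z.2 :=
        Fintype.sum_equiv (MulAction.selfEquivSigmaOrbits Q X) _ _ fun _ => rfl
      _ = ∑ ω : MulAction.orbitRel.Quotient Q X, ∑ y : MulAction.orbit Q ω.out,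
          b.repr v y • b y := Fintype.sum_sigma _
      _ = _ := Fintype.sum_congr _ _ fun ω => by
        rw [Finset.smul_sum]
        refine Fintype.sum_congr _ _ ?_
        rintro ⟨_, q, rfl⟩
        exact congrArg (· • b _) (hb.repr_eq_of_mem_fixedBy hv q ω.out)
  rw [hsum]
  refine Submodule.sum_mem _ fun ω _ => Submodule.smul_mem _ _ (Submodule.subset_span ⟨ω.out, ?_⟩)
  exact finsum_eq_sum_of_fintype _

end IsPermutationBasis

variable {p : ℕ} [Fact p.Prime] [Finite G]

lemma relTrace_apply_of_mem_fixedBy (R : Subgroup G) {v : V} (hv : v ∈ ρ.fixedBy Q) :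
    ρ.relTrace R Q v = (R.relIndex Q : k) • v := by
  have := Fintype.ofFinite (Q ⧸ R.subgroupOf Q)
  have hterm : ∀ x : Q ⧸ R.subgroupOf Q, ρ (x.out : Q) v = v := fun x =>
    mem_fixedBy.1 hv _ x.out.2
  rw [relTrace_apply, finsum_congr hterm, finsum_eq_sum_of_fintype, Finset.sum_const,
    Finset.card_univ, ← Nat.card_eq_fintype_card, Nat.cast_smul_eq_nsmul]
  rfl

lemma traceSum_eq_bot_of_le_ker [CharP k p] (hQ : IsPGroup p Q) (h : Q ≤ MonoidHom.ker ρ) :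
    ρ.traceSum Q = ⊥ := by
  refine eq_bot_iff.2 (iSup₂_le fun R hR => ?_)
  rintro _ ⟨v, -, rfl⟩
  have hv : v ∈ ρ.fixedBy Q := fixedBy_eq_top_of_le_ker h ▸ Submodule.mem_top
  rw [Submodule.mem_bot, relTrace_apply_of_mem_fixedBy R hv,
    (CharP.cast_eq_zero_iff k p _).2 (dvd_relIndex_of_lt hQ hR), zero_smul]

lemma not_subsingleton_brauer_of_le_ker [CharP k p] [Nontrivial V] (hQ : IsPGroup p Q)
    (h : Q ≤ MonoidHom.ker ρ) :
    ¬ Subsingleton (ρ.fixedBy Q ⧸ (ρ.traceSum Q).submoduleOf (ρ.fixedBy Q)) := by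
  rw [subsingleton_brauer_iff, traceSum_eq_bot_of_le_ker hQ h, fixedBy_eq_top_of_le_ker h,
    le_bot_iff]
  exact top_ne_bot

theorem isIndecomposable_brauer_comp_iff [CharP k p] (hQ : IsPGroup p Q)
    (h : Q ≤ MonoidHom.ker ρ) {H : Subgroup G} (hH : H ≤ Subgroup.normalizer (Q : Set G)) :
    IsIndecomposable ((ρ.brauer Q).comp
        (H.subgroupOf (Subgroup.normalizer (Q : Set G))).subtype) ↔
      IsIndecomposable (ρ.comp H.subtype) := by
  have hbot : (ρ.traceSum Q).submoduleOf (ρ.fixedBy Q) = ⊥ := by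
    rw [traceSum_eq_bot_of_le_ker hQ h, Submodule.submoduleOf, Submodule.comap_bot,
      Submodule.ker_subtype]
  let e := (Submodule.quotEquivOfEqBot _ hbot).trans
    (LinearEquiv.ofTop _ (fixedBy_eq_top_of_le_ker h))
  refine isIndecomposable_iff_of_linearEquiv e (f := (Subgroup.subgroupOfEquivOfLe hH).toMonoidHom)
    (Subgroup.subgroupOfEquivOfLe hH).surjective fun g v => ?_
  obtain ⟨v, rfl⟩ := Submodule.Quotient.mk_surjective _ v
  rfl

namespace IsPermutationBasis

variable [MulAction G X] {b : Module.Basis X k V}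

lemma relTrace_apply_basis (hb : IsPermutationBasis ρ b) (Q : Subgroup G) (x : X) :
    ρ.relTrace ((MulAction.stabilizer Q x).map Q.subtype) Q (b x) =
      ∑ᶠ y : MulAction.orbit Q x, b y := by
  have hstab : ((MulAction.stabilizer Q x).map Q.subtype).subgroupOf Q =
      MulAction.stabilizer Q x := Subgroup.comap_map_eq_self_of_injective Q.subtype_injective _
  let e := (Subgroup.quotientEquivOfEq hstab).trans
    (MulAction.orbitEquivQuotientStabilizer Q x).symm
  have he : ∀ q, (e q : X) = (q.out : Q) • x := fun q => by
    conv_lhs => rw [← q.out_eq']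
    exact MulAction.orbitEquivQuotientStabilizer_symm_apply Q x q.out
  rw [relTrace_apply]
  exact finsum_eq_of_bijective e e.bijective fun q => by rw [he, hb]; rfl

lemma fixedBy_le_traceSum [Finite X] (hb : IsPermutationBasis ρ b)
    (hQ : ∀ x : X, ¬ Q ≤ MulAction.stabilizer G x) : ρ.fixedBy Q ≤ ρ.traceSum Q := by
  refine fun v hv => Submodule.span_le.2 ?_ (hb.mem_span_orbit_sums hv)
  rintro _ ⟨x, rfl⟩
  have hlt : (MulAction.stabilizer Q x).map Q.subtype < Q := by
    refine lt_of_le_not_ge (Subgroup.map_subtype_le _) fun hle => hQ x fun q hq => ?_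
    obtain ⟨s, hs, rfl⟩ := hle hq
    exact hs
  have hfix : b x ∈ ρ.fixedBy ((MulAction.stabilizer Q x).map Q.subtype) :=
    mem_fixedBy.2 <| by
      rintro _ ⟨s, hs, rfl⟩
      exact (hb _ x).trans (congrArg b hs)
  exact Submodule.mem_iSup_of_mem _
    (Submodule.mem_iSup_of_mem hlt ⟨b x, hfix, hb.relTrace_apply_basis Q x⟩)

end IsPermutationBasis

lemma subsingleton_brauer_of_not_le {L : Subgroup G} [L.Normal] {b : Module.Basis (G ⧸ L) k V}
    (hb : IsPermutationBasis ρ b) (hQ : ¬ Q ≤ L) :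
    Subsingleton (ρ.fixedBy Q ⧸ (ρ.traceSum Q).submoduleOf (ρ.fixedBy Q)) :=
  subsingleton_brauer_iff.2 <| hb.fixedBy_le_traceSum fun x =>
    (stabilizer_quotient_of_normal x).symm ▸ hQ

end Brauer

section BrauerIndecomposable

variable {p : ℕ} [Fact p.Prime] {k G V : Type*} [Field k] [CharP k p] [Group G] [Finite G]
  [AddCommGroup V] [Module k V] {ρ : Representation k G V}

lemma isIndecomposable_comp_of_isBrauerIndecomposable [Nontrivial V]
    (hρ : IsBrauerIndecomposable p ρ) {Q : Subgroup G} (hQ : IsPGroup p Q)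
    (h : Q ≤ MonoidHom.ker ρ) :
    IsIndecomposable (ρ.comp (Q ⊔ Subgroup.centralizer (Q : Set G)).subtype) :=
  (isIndecomposable_brauer_comp_iff hQ h
    (sup_le Subgroup.le_normalizer (Subgroup.centralizer_le_normalizer _))).1
    ((hρ Q hQ).resolve_right (not_subsingleton_brauer_of_le_ker hQ h))

theorem IsPermutationBasis.isBrauerIndecomposable_iff {L : Subgroup G} [L.Normal]
    {b : Module.Basis (G ⧸ L) k V} (hb : IsPermutationBasis ρ b) (hGL : IsPGroup p (G ⧸ L)) :
    IsBrauerIndecomposable p ρ ↔ ∀ Q : Subgroup G, IsPGroup p Q → Q ≤ L →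
      Subgroup.centralizer (Q : Set G) ⊔ L = ⊤ := by
  have hiff : ∀ Q : Subgroup G, Q ≤ L →
      (IsIndecomposable (ρ.comp (Q ⊔ Subgroup.centralizer (Q : Set G)).subtype) ↔
        Subgroup.centralizer (Q : Set G) ⊔ L = ⊤) := fun Q hQL => by
    rw [hb.isIndecomposable_comp_subtype_iff hGL, sup_comm Q, sup_assoc, sup_eq_right.2 hQL]
  have : Nontrivial V := ⟨b (1 : G), 0, b.ne_zero _⟩
  constructor
  · intro h Q hQ hQL
    exact (hiff Q hQL).1 <|
      isIndecomposable_comp_of_isBrauerIndecomposable h hQ (hb.ker_eq_of_normal.ge.trans' hQL)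
  · intro h Q hQ
    by_cases hQL : Q ≤ L
    · refine Or.inl <| (isIndecomposable_brauer_comp_iff hQ (hb.ker_eq_of_normal.ge.trans' hQL)
        (sup_le Subgroup.le_normalizer (Subgroup.centralizer_le_normalizer _))).2 ?_
      exact (hiff Q hQL).2 (h Q hQ hQL)
    · exact Or.inr (subsingleton_brauer_of_not_le hb hQL)

end BrauerIndecomposable

section Averaging

variable {k G V : Type*} [Field k] [Group G] [AddCommGroup V] [Module k V]
  {ρ : Representation k G V} {K : Subgroup G} [K.Normal]

lemma averageMap_comp_subtype_comm [Fintype K] [Invertible (Fintype.card K : k)] (g : G) :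
    averageMap (ρ.comp K.subtype) ∘ₗ ρ g = ρ g ∘ₗ averageMap (ρ.comp K.subtype) := by
  have happly : ∀ v, averageMap (ρ.comp K.subtype) v = ⅟(Fintype.card K : k) • ∑ x : K, ρ x v :=
    fun v => by simp [GroupAlgebra.average]
  refine LinearMap.ext fun v => ?_
  rw [LinearMap.comp_apply, LinearMap.comp_apply, happly, happly, map_smul, map_sum,
    ← (MulAut.conjNormal (H := K) g).toEquiv.sum_comp]
  congr 1
  refine Finset.sum_congr rfl fun x _ => ?_
  simp only [← Module.End.mul_apply, ← map_mul]
  simp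

theorem le_ker_of_isIndecomposable (hρ : IsIndecomposable ρ) (hK : (Nat.card K : k) ≠ 0)
    {v : V} (hv : v ∈ ρ.fixedBy K) (hv0 : v ≠ 0) : K ≤ MonoidHom.ker ρ := by
  have : Finite K := Nat.finite_of_card_ne_zero fun h => hK (by rw [h, Nat.cast_zero])
  have := Fintype.ofFinite K
  have : Invertible (Fintype.card K : k) :=
    invertibleOfNonzero (Nat.card_eq_fintype_card (α := K) ▸ hK)
  have hproj := isProj_averageMap (ρ.comp K.subtype)
  let e : IntertwiningMap ρ ρ := ⟨averageMap (ρ.comp K.subtype), averageMap_comp_subtype_comm⟩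
  have he : IsIdempotentElem e := IntertwiningMap.ext hproj.isIdempotentElem
  rcases eq_zero_or_eq_one_of_isIdempotentElem hρ he with h | h
  · refine absurd ?_ hv0
    calc v = e v := (hproj.map_id v hv).symm
      _ = 0 := DFunLike.congr_fun h v
  · intro g hg
    refine LinearMap.ext fun w => mem_fixedBy.1 ?_ g hg
    have hw : e w = w := DFunLike.congr_fun h w
    exact hw ▸ hproj.map_mem w

end Averaging

section FrobeniusReciprocity

variable {k G V W : Type*} [Field k] [Group G] [AddCommGroup V] [Module k V] [AddCommGroup W]
  [Module k W] {ρ : Representation k G V} {τ : Representation k G W} {P L : Subgroup G}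

lemma mem_fixedBy_sup {v : V} :
    v ∈ ρ.fixedBy (P ⊔ L) ↔ v ∈ ρ.fixedBy P ∧ v ∈ ρ.fixedBy L := by
  let _ : MulAction G V := MulAction.compHom V ρ
  have hstab : ∀ H : Subgroup G, v ∈ ρ.fixedBy H ↔ H ≤ MulAction.stabilizer G v :=
    fun H => mem_fixedBy
  simp only [hstab, sup_le_iff]

lemma map_mem_fixedBy (f : IntertwiningMap τ ρ) {w : W} (hw : w ∈ τ.fixedBy P) :
    f w ∈ ρ.fixedBy P :=
  mem_fixedBy.2 fun g hg => by rw [← f.isIntertwining, mem_fixedBy.1 hw g hg]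

lemma indMk_one_mem_fixedBy :
    IndV.mk P.subtype (trivial k P k) 1 1 ∈ (ind P.subtype (trivial k P k)).fixedBy P := by
  refine mem_fixedBy.2 fun g hg => ?_
  have hcoinv := Coinvariants.mk_self_apply
    (tprod ((leftRegular k G).comp P.subtype) (trivial k P k)) ⟨g⁻¹, inv_mem hg⟩
    (MonoidAlgebra.single 1 1 ⊗ₜ 1)
  rw [ind_mk]
  simpa using hcoinv

lemma indMk_eq_ind_apply (g : G) : IndV.mk P.subtype (trivial k P k) g 1 =
    ind P.subtype (trivial k P k) g⁻¹ (IndV.mk _ _ 1 1) := by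
  rw [ind_mk, one_mul, inv_inv]

lemma le_ker_ind_of_normal [P.Normal] : P ≤ MonoidHom.ker (ind P.subtype (trivial k P k)) := by
  intro g hg
  refine IndV.hom_ext _ _ fun h => LinearMap.ext_ring ?_
  have hh : h⁻¹ ∈ Subgroup.normalizer (P : Set G) := Subgroup.normalizer_eq_top P ▸ trivial
  have hmem : IndV.mk P.subtype (trivial k P k) h 1 ∈
      (ind P.subtype (trivial k P k)).fixedBy P := by
    rw [indMk_eq_ind_apply]
    exact fixedBy_le_comap _ P ⟨h⁻¹, hh⟩ indMk_one_mem_fixedBy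
  exact mem_fixedBy.1 hmem g hg

lemma intertwiningMap_ext_of_indMk_one
    {f₁ f₂ : IntertwiningMap (ind P.subtype (trivial k P k)) ρ}
    (h : f₁ (IndV.mk _ _ 1 1) = f₂ (IndV.mk _ _ 1 1)) : f₁ = f₂ := by
  refine IntertwiningMap.ext (IndV.hom_ext _ _ fun g => LinearMap.ext_ring ?_)
  change f₁ (IndV.mk _ _ g 1) = f₂ (IndV.mk _ _ g 1)
  rw [indMk_eq_ind_apply, f₁.isIntertwining, f₂.isIntertwining, h]

lemma exists_intertwiningMap_indMk_one {v : V} (hv : v ∈ ρ.fixedBy P) :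
    ∃ f : IntertwiningMap (ind P.subtype (trivial k P k)) ρ, f (IndV.mk _ _ 1 1) = v := by
  let φ : MonoidAlgebra k G →ₗ[k] V := (MonoidAlgebra.basis G k).constr k fun h => ρ h⁻¹ v
  have hφ : ∀ h, φ (MonoidAlgebra.single h 1) = ρ h⁻¹ v :=
    (MonoidAlgebra.basis G k).constr_basis k _
  let f : IndV P.subtype (trivial k P k) →ₗ[k] V :=
    Coinvariants.lift _ (φ ∘ₗ (_root_.TensorProduct.rid k _).toLinearMap) fun x => by
      ext h
      simp [hφ, mem_fixedBy.1 hv _ (inv_mem x.2)]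
  have hf : ∀ h, f (IndV.mk _ _ h 1) = ρ h⁻¹ v := fun h => by simp [f, hφ]
  refine ⟨⟨f, fun g => IndV.hom_ext _ _ fun h => LinearMap.ext_ring ?_⟩, ?_⟩
  · change f (ind _ _ g (IndV.mk _ _ h 1)) = ρ g (f (IndV.mk _ _ h 1))
    rw [ind_mk, hf, hf, mul_inv_rev, inv_inv, map_mul, Module.End.mul_apply]
  · exact (hf 1).trans (by simp)

namespace IsPermutationBasis

variable {c : Module.Basis (G ⧸ L) k W}

lemma basis_one_mem_fixedBy (hc : IsPermutationBasis τ c) :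
    c (1 : G) ∈ τ.fixedBy L :=
  mem_fixedBy.2 fun g hg => (hc g _).trans <| congrArg c <| by
    rw [← MulAction.mem_stabilizer_iff, MulAction.stabilizer_quotient]
    exact hg

lemma exists_intertwiningMap_basis_one (hc : IsPermutationBasis τ c) {v : V}
    (hv : v ∈ ρ.fixedBy L) : ∃ f : IntertwiningMap τ ρ, f (c (1 : G)) = v := by
  let f : W →ₗ[k] V := c.constr k fun x => ρ x.out v
  have hf : ∀ g : G, f (c g) = ρ g v := fun g => by
    obtain ⟨l, hl⟩ := QuotientGroup.mk_out_eq_mul L g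
    rw [c.constr_basis, hl, map_mul, Module.End.mul_apply, mem_fixedBy.1 hv _ l.2]
  refine ⟨⟨f, fun g => c.ext fun x => ?_⟩, ?_⟩
  · obtain ⟨a, rfl⟩ := QuotientGroup.mk_surjective x
    rw [LinearMap.comp_apply, LinearMap.comp_apply, hc, hf, MulAction.Quotient.smul_mk, hf,
      smul_eq_mul, map_mul, Module.End.mul_apply]
  · exact (hf 1).trans (by simp)

lemma map (hc : IsPermutationBasis τ c) {f : IntertwiningMap τ ρ} (hf : Function.Bijective f) :
    IsPermutationBasis ρ (c.map (LinearEquiv.ofBijective f.toLinearMap hf)) := fun g x => by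
  simp only [Module.Basis.map_apply, ← hc g x]
  exact (IntertwiningMap.isIntertwining _ _ f g (c x)).symm

end IsPermutationBasis

lemma isPermutationBasis_ofMulAction {X : Type*} [MulAction G X] :
    IsPermutationBasis (ofMulAction k G X) (MonoidAlgebra.basis X k) :=
  fun g x => ofMulAction_single g x 1

end FrobeniusReciprocity

section ScottModules

variable {p : ℕ} [Fact p.Prime] {k G V : Type*} [Field k] [CharP k p] [Group G] [AddCommGroup V]
  [Module k V] {ρ : Representation k G V} {P K : Subgroup G}

lemma exists_mem_invariants_ne_zero_of_isScottModule (h : IsScottModule P ρ) :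
    ∃ v ∈ invariants ρ, v ≠ 0 := by
  obtain ⟨-, -, U, ⟨e⟩⟩ := h
  refine ⟨e 1, fun g => ?_, fun h1 => ?_⟩
  · exact (congrArg Subtype.val (IntertwiningMap.isIntertwining _ _ e.toIntertwiningMap g 1)).symm
  · exact one_ne_zero (e.toLinearEquiv.map_eq_zero_iff.1 (Subtype.ext h1))

lemma le_ker_of_isScottModule_of_normal [P.Normal] (h : IsScottModule P ρ) :
    P ≤ MonoidHom.ker ρ := by
  obtain ⟨i, π, hπi⟩ := exists_comp_eq_id_of_isSummandOf h.2.1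
  intro g hg
  refine LinearMap.ext fun v => ?_
  have hv : π (i v) = v := DFunLike.congr_fun hπi v
  rw [← hv, ← π.isIntertwining, le_ker_ind_of_normal hg]
  rfl

variable [K.Normal]

lemma le_ker_of_isScottModule_of_coprime (h : IsScottModule P ρ) (hK : (Nat.card K).Coprime p) :
    K ≤ MonoidHom.ker ρ := by
  obtain ⟨v, hv, hv0⟩ := exists_mem_invariants_ne_zero_of_isScottModule h
  have hcard : (Nat.card K : k) ≠ 0 := fun h0 =>
    (Fact.out : p.Prime).ne_one (hK.symm.eq_one_of_dvd ((CharP.cast_eq_zero_iff k p _).1 h0))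
  exact le_ker_of_isIndecomposable h.1 hcard (mem_fixedBy.2 fun g _ => hv g) hv0

theorem exists_isPermutationBasis_of_isScottModule [K.FiniteIndex] (h : IsScottModule P ρ)
    (hK : (Nat.card K).Coprime p) (hGK : IsPGroup p (G ⧸ K)) :
    ∃ b : Module.Basis (G ⧸ (K ⊔ P)) k V, IsPermutationBasis ρ b := by
  let c := MonoidAlgebra.basis (G ⧸ (K ⊔ P)) k
  have hc : IsPermutationBasis (ofMulAction k G (G ⧸ (K ⊔ P))) c := isPermutationBasis_ofMulAction
  have hind : IsIndecomposable (ofMulAction k G (G ⧸ (K ⊔ P))) := by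
    refine hc.isIndecomposable (N := K) ?_ hGK
    rw [hc.ker_eq_normalCore]
    exact Subgroup.normal_le_normalCore.2 le_sup_left
  obtain ⟨i, π, hπi⟩ := exists_comp_eq_id_of_isSummandOf h.2.1
  have hmK : π (IndV.mk _ _ 1 1) ∈ ρ.fixedBy K :=
    fixedBy_eq_top_of_le_ker (le_ker_of_isScottModule_of_coprime h hK) ▸ Submodule.mem_top
  have hmP : π (IndV.mk _ _ 1 1) ∈ ρ.fixedBy P := map_mem_fixedBy π indMk_one_mem_fixedBy
  obtain ⟨f, hf⟩ := hc.exists_intertwiningMap_basis_one (mem_fixedBy_sup.2 ⟨hmK, hmP⟩)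
  obtain ⟨s, hs⟩ := exists_intertwiningMap_indMk_one
    (mem_fixedBy_sup.1 hc.basis_one_mem_fixedBy).2
  have hfs : f.comp s = π :=
    intertwiningMap_ext_of_indMk_one ((congrArg f hs).trans hf)
  have := h.1.1
  have hbij : Function.Bijective f := bijective_of_comp_eq_id hind (s := s.comp i) <| by
    rw [← hπi, ← hfs]
    rfl
  exact ⟨_, hc.map hbij⟩

lemma isIndecomposable_comp_iff_of_isScottModule [K.FiniteIndex] [P.Normal] (h : IsScottModule P ρ)
    (hK : (Nat.card K).Coprime p) (hGK : IsPGroup p (G ⧸ K)) {H : Subgroup G} :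
    IsIndecomposable (ρ.comp H.subtype) ↔ H ⊔ (K ⊔ P) = ⊤ := by
  obtain ⟨b, hb⟩ := exists_isPermutationBasis_of_isScottModule h hK hGK
  have : (K ⊔ P).FiniteIndex := Subgroup.finiteIndex_of_le le_sup_left
  exact hb.isIndecomposable_comp_subtype_iff (isPGroup_quotient_mono le_sup_left hGK)

end ScottModules

section Sylow

open scoped Pointwise

variable {p : ℕ} {G : Type*} [Group G]

lemma exists_normal_isPGroup_quotient (hG : IsPNilpotent p G) :
    ∃ K : Subgroup G, ∃ _ : K.Normal, (Nat.card K).Coprime p ∧ IsPGroup p (G ⧸ K) := by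
  obtain ⟨K, S, hK, hcop, hKS⟩ := hG
  refine ⟨K, hK, hcop, S.2.of_surjective ((QuotientGroup.mk' K).comp (S : Subgroup G).subtype) ?_⟩
  rw [← MonoidHom.range_eq_top, MonoidHom.range_comp, Subgroup.range_subtype,
    ← (Subgroup.comap_injective (QuotientGroup.mk'_surjective K)).eq_iff, Subgroup.comap_map_eq,
    QuotientGroup.ker_mk', sup_comm, hKS, Subgroup.comap_top]

lemma relIndex_sup_dvd_card (K P : Subgroup G) [K.Normal] [Finite P] :
    P.relIndex (K ⊔ P) ∣ Nat.card K := by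
  have hP : Nat.card P * P.relIndex (K ⊔ P) = Nat.card K * K.relIndex P := by
    rw [← Subgroup.relIndex_sup_left (K := K), ← Subgroup.relIndex_bot_left P,
      ← Subgroup.relIndex_bot_left K, Subgroup.relIndex_mul_relIndex _ _ _ bot_le le_sup_right,
      Subgroup.relIndex_mul_relIndex _ _ _ bot_le le_sup_left]
  refine Nat.dvd_of_mul_dvd_mul_left (Nat.card_pos (α := P)) ?_
  rw [hP, mul_comm (Nat.card P)]
  exact mul_dvd_mul_left _ (K.relIndex_dvd_card P)

lemma exists_sylow_map_subtype_eq [Fact p.Prime] {K P : Subgroup G} [K.Normal] [Finite P]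
    (hK : (Nat.card K).Coprime p) (hP : IsPGroup p P) :
    ∃ S : Sylow p ↥(K ⊔ P), (S : Subgroup ↥(K ⊔ P)).map (K ⊔ P).subtype = P := by
  have hindex : ¬ p ∣ (P.subgroupOf (K ⊔ P)).index := fun h =>
    (Fact.out : p.Prime).ne_one (hK.symm.eq_one_of_dvd (h.trans (relIndex_sup_dvd_card K P)))
  have hP' : IsPGroup p (P.subgroupOf (K ⊔ P)) := hP.comap_subtype
  refine ⟨hP'.toSylow hindex, ?_⟩
  rw [IsPGroup.toSylow_coe, Subgroup.subgroupOf_map_subtype, inf_eq_left.2 le_sup_right]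

variable [Fact p.Prime] {L : Subgroup G} [Finite (Sylow p L)] (S : Sylow p L)

lemma exists_conj_mem_map_subtype {Q : Subgroup G} (hQ : IsPGroup p Q) (hQL : Q ≤ L) :
    ∃ x ∈ L, ∀ q ∈ Q, x⁻¹ * q * x ∈ (S : Subgroup L).map L.subtype := by
  obtain ⟨T, hT⟩ := (hQ.comap_subtype (K := L)).exists_le_sylow
  obtain ⟨x, rfl⟩ := MulAction.exists_smul_eq L S T
  refine ⟨x, x.2, fun q hq => ?_⟩
  have hmem : (⟨q, hQL hq⟩ : L) ∈ MulAut.conj x • (S : Subgroup L) := hT hq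
  rw [Subgroup.mem_pointwise_smul_iff_inv_smul_mem] at hmem
  exact ⟨_, hmem, by simp [← map_inv]⟩

theorem centralizer_sup_eq_top [L.Normal]
    (hN : Subgroup.normalizer ((S : Subgroup L).map L.subtype : Set G) ≤
      Subgroup.centralizer ((S : Subgroup L).map L.subtype : Set G) ⊔ L)
    {Q : Subgroup G} (hQ : IsPGroup p Q) (hQL : Q ≤ L) :
    Subgroup.centralizer (Q : Set G) ⊔ L = ⊤ := by
  obtain ⟨x, hx, hxQ⟩ := exists_conj_mem_map_subtype S hQ hQL
  have hcent : Subgroup.centralizer ((S : Subgroup L).map L.subtype : Set G) ≤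
      Subgroup.centralizer (Q : Set G) ⊔ L := fun c hc => by
    have hxc : x * c * x⁻¹ ∈ Subgroup.centralizer (Q : Set G) := by
      refine Subgroup.mem_centralizer_iff.2 fun q hq => ?_
      calc q * (x * c * x⁻¹) = x * (x⁻¹ * q * x * c) * x⁻¹ := by group
        _ = x * c * x⁻¹ * q := by
          rw [Subgroup.mem_centralizer_iff.1 hc _ (hxQ q hq)]; group
    have hxL : x ∈ Subgroup.centralizer (Q : Set G) ⊔ L := Subgroup.mem_sup_right hx
    simpa [mul_assoc] using
      mul_mem (mul_mem (inv_mem hxL) (Subgroup.mem_sup_left hxc)) hxL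
  rw [eq_top_iff, ← Sylow.normalizer_sup_eq_top S]
  exact sup_le (hN.trans (sup_le hcent le_sup_right)) le_sup_right

lemma centralizer_subgroupOf {P N : Subgroup G} (hPN : P ≤ N) :
    Subgroup.centralizer (P.subgroupOf N : Set N) =
      (Subgroup.centralizer (P : Set G)).subgroupOf N := by
  ext c
  rw [Subgroup.mem_subgroupOf, Subgroup.mem_centralizer_iff, Subgroup.mem_centralizer_iff]
  exact ⟨fun hc q hq => congrArg Subtype.val (hc ⟨q, hPN hq⟩ hq),
    fun hc q hq => Subtype.ext (hc q hq)⟩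

end Sylow

section PNilpotent

variable {p : ℕ} [Fact p.Prime] {k G V : Type*} [Field k] [CharP k p] [Group G] [AddCommGroup V]
  [Module k V] {P K : Subgroup G} [K.Normal] [K.FiniteIndex]

lemma normal_sup_of_le_ker {ρ : Representation k G V} (hρ : IsScottModule P ρ)
    (hK : (Nat.card K).Coprime p) (hGK : IsPGroup p (G ⧸ K)) (hP : P ≤ MonoidHom.ker ρ) :
    (K ⊔ P).Normal := by
  obtain ⟨b, hb⟩ := exists_isPermutationBasis_of_isScottModule hρ hK hGK
  have hle : K ⊔ P ≤ MonoidHom.ker ρ := sup_le (le_ker_of_isScottModule_of_coprime hρ hK) hP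
  have hcore : (K ⊔ P).normalCore = K ⊔ P :=
    le_antisymm (Subgroup.normalCore_le _) (hle.trans hb.ker_eq_normalCore.le)
  exact hcore ▸ Subgroup.normalCore_normal _

lemma normalizer_le_centralizer_sup
    {σ : Representation k (Subgroup.normalizer (P : Set G)) V}
    (hσ : IsScottModule (P.subgroupOf (Subgroup.normalizer (P : Set G))) σ)
    (hσP : IsIndecomposable (σ.comp
      (P.subgroupOf (Subgroup.normalizer (P : Set G)) ⊔ Subgroup.centralizer
        (P.subgroupOf (Subgroup.normalizer (P : Set G)) : Set _)).subtype))
    (hK : (Nat.card K).Coprime p) (hGK : IsPGroup p (G ⧸ K)) :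
    Subgroup.normalizer (P : Set G) ≤ Subgroup.centralizer (P : Set G) ⊔ (K ⊔ P) := by
  set N := Subgroup.normalizer (P : Set G)
  have hKN : (Nat.card (K.subgroupOf N)).Coprime p :=
    hK.coprime_dvd_left (Subgroup.card_comap_dvd_of_injective K _ N.subtype_injective)
  have hN : P.subgroupOf N ⊔ Subgroup.centralizer (P.subgroupOf N : Set N) ⊔
      (K.subgroupOf N ⊔ P.subgroupOf N) = ⊤ :=
    (isIndecomposable_comp_iff_of_isScottModule hσ hKN (isPGroup_quotient_subgroupOf hGK N)).1 hσP
  rw [centralizer_subgroupOf Subgroup.le_normalizer] at hN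
  rw [← Subgroup.subgroupOf_eq_top, eq_top_iff, ← hN]
  have hmono : Monotone fun H : Subgroup G => H.subgroupOf N := fun _ _ => Subgroup.comap_mono
  exact sup_le
    (sup_le (hmono (le_sup_right.trans le_sup_right)) (hmono le_sup_left))
    (sup_le (hmono (le_sup_left.trans le_sup_right)) (hmono (le_sup_right.trans le_sup_right)))

end PNilpotent

end ScottModule

theorem mainTheorem4_general {p : ℕ} [Fact p.Prime] {k : Type*} [Field k] [CharP k p]
    {G : Type*} [Group G] [Finite G] (hG : IsPNilpotent p G)
    (P : Subgroup G) (hP : IsPGroup p P)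
    {M : Type*} [AddCommGroup M] [Module k M] (ρ : Representation k G M)
    (hρ : Representation.IsScottModule P ρ) (hker : P ≤ MonoidHom.ker ρ)
    {N : Type*} [AddCommGroup N] [Module k N]
    (σ : Representation k (Subgroup.normalizer (P : Set G)) N)
    (hσ : Representation.IsScottModule (P.subgroupOf (Subgroup.normalizer (P : Set G))) σ)
    (hσP : Representation.IsIndecomposable (σ.comp
      (P.subgroupOf (Subgroup.normalizer (P : Set G)) ⊔ Subgroup.centralizer
        (P.subgroupOf (Subgroup.normalizer (P : Set G)) : Set _)).subtype)) :
    Representation.IsBrauerIndecomposable p ρ := by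
  obtain ⟨K, _, hK, hGK⟩ := ScottModule.exists_normal_isPGroup_quotient hG
  obtain ⟨b, hb⟩ := ScottModule.exists_isPermutationBasis_of_isScottModule hρ hK hGK
  have hKP : (K ⊔ P).Normal := ScottModule.normal_sup_of_le_ker hρ hK hGK hker
  have hN : Subgroup.normalizer (P : Set G) ≤ Subgroup.centralizer (P : Set G) ⊔ (K ⊔ P) :=
    ScottModule.normalizer_le_centralizer_sup hσ hσP hK hGK
  obtain ⟨S, hS⟩ := ScottModule.exists_sylow_map_subtype_eq hK hP
  have hGL : IsPGroup p (G ⧸ (K ⊔ P)) := ScottModule.isPGroup_quotient_mono le_sup_left hGK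
  exact (hb.isBrauerIndecomposable_iff hGL).2 fun Q hQ hQL =>
    ScottModule.centralizer_sup_eq_top S (hS.symm ▸ hN) hQ hQL

theorem mainTheorem4 {p : ℕ} [Fact p.Prime] {k : Type*} [Field k] [IsAlgClosed k] [CharP k p]
    {G : Type*} [Group G] [Finite G] (hG : IsPNilpotent p G)
    (P : Subgroup G) (hP : IsPGroup p P) (hP1 : P ≠ ⊥)
    {M : Type*} [AddCommGroup M] [Module k M] (ρ : Representation k G M)
    (hρ : Representation.IsScottModule P ρ) (hker : P ≤ MonoidHom.ker ρ)
    {N : Type*} [AddCommGroup N] [Module k N]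
    (σ : Representation k (Subgroup.normalizer (P : Set G)) N)
    (hσ : Representation.IsScottModule (P.subgroupOf (Subgroup.normalizer (P : Set G))) σ)
    (hσB : Representation.IsBrauerIndecomposable p σ) :
    Representation.IsBrauerIndecomposable p ρ :=
  have := hσ.1.1
  mainTheorem4_general hG P hP ρ hρ hker σ hσ <|
    ScottModule.isIndecomposable_comp_of_isBrauerIndecomposable hσB hP.comap_subtype
      (ScottModule.le_ker_of_isScottModule_of_normal hσ)
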